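/- Let $\mathcal P=\{P_i\}_{i\in I}$ be a finite set of mutually independent random variables on a probability space. An evaluation of $\mathcal P$ assigns a value to each variable. Let $\mathcal A$ be a finite set of events determined by these variables: each $A\in\mathcal A$ is given by the (measurable) set of the evaluations that violate $A$, i.e. that make $A$ happen. Let $\mathrm{vbl}(A)\subseteq\mathcal P$ be the smallest set of variables that determines $A$, and for $A\in\mathcal A$ let $$\Gamma(A)=\{B\in\mathcal A : B\neq A,\ \mathrm{vbl}(A)\cap\mathrm{vbl}(B)\neq\emptyset\}.$$ Suppose there is an assignment $x:\mathcal A\to(0,1)$ with $$\Pr[A]\le x(A)\prod_{B\in\Gamma(A)}(1-x(B))\qquad\text{for all }A\in\mathcal A .$$ Then there is an assignment of values to the variables $\mathcal P$ (indeed values that they take simultaneously at some point of the probability space) that violates no event in $\mathcal A$. Moreover, consider the sequential resampling algorithm: draw a random sample of every variable $P\in\mathcal P$; while the current evaluation violates some event in $\mathcal A$, select an arbitrary violated event $A$ and replace the current value of each $P\in\mathrm{vbl}(A)$ by a new random sample of $P$, keeping the values of the other variables. Here each new sample of a variable $P$ is the next unused element of a sequence of samples of $P$, all the samples of all the variables being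 mutually independent and each sample of $P$ having the distribution of $P$; the violated event may be selected by any procedure, deterministic or randomized. Then each event $A\in\mathcal A$ is resampled an expected number of at most $\dfrac{x(A)}{1-x(A)}$ times, and the expected total number of resampling steps is at most $\displaystyle\sum_{A\in\mathcal A}\frac{x(A)}{1-x(A)}$. In particular, with probability $1$ the algorithm stops after finitely many steps, at an evaluation that violates no event in $\mathcal A$. -/

import Mathlib

open MeasureTheory ProbabilityTheory
open scoped ENNReal

namespace MoserTardos

section Events

variable {ι : Type*} {E : ι → Type*} {α : Type*}

/-- An event determined by variables `P i` (`i : ι`) with values in `E i` is given by the set `A` of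
the evaluations `v : ∀ i, E i` that violate it (make it happen). It is determined by the variables
in `S` if the values of these variables decide whether it happens. -/
def DeterminedBy (A : Set (∀ i, E i)) (S : Finset ι) : Prop :=
  ∀ v w : ∀ i, E i, (∀ i ∈ S, v i = w i) → (v ∈ A ↔ w ∈ A)

/-- If two sets of variables determine an event, so does their intersection. -/
theorem DeterminedBy.inter [DecidableEq ι] {A : Set (∀ i, E i)} {S T : Finset ι}
    (hS : DeterminedBy A S) (hT : DeterminedBy A T) : DeterminedBy A (S ∩ T) := by
  intro v w h
  have h1 : v ∈ A ↔ (fun i => if i ∈ S then v i else w i) ∈ A :=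
    hS _ _ fun i hi => by simp [hi]
  have h2 : (fun i => if i ∈ S then v i else w i) ∈ A ↔ w ∈ A :=
    hT _ _ fun i hi => by
      by_cases hiS : i ∈ S
      · simpa [hiS] using h i (Finset.mem_inter.2 ⟨hiS, hi⟩)
      · simp [hiS]
  exact h1.trans h2

variable [Fintype ι]

open scoped Classical in
/-- `vbl A`: the smallest set of variables that determines the event `A`
(see `isLeast_vbl`). -/
noncomputable def vbl (A : Set (∀ i, E i)) : Finset ι :=
  Finset.univ.filter fun i => ∀ S : Finset ι, DeterminedBy A S → i ∈ S

/-- `vbl A` determines `A` and is contained in every set of variables that does. -/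
theorem isLeast_vbl (A : Set (∀ i, E i)) : IsLeast {S | DeterminedBy A S} (vbl A) := by
  classical
  have key : ∀ F : Finset (Finset ι), (∀ S ∈ F, DeterminedBy A S) →
      DeterminedBy A (F.inf id) := by
    intro F
    induction F using Finset.induction_on with
    | empty =>
      intro _ v w h
      have hvw : v = w := funext fun i => h i (by simp)
      rw [hvw]
    | insert S F _ ih =>
      intro h
      rw [Finset.inf_insert]
      exact (h S (by simp)).inter (ih fun T hT => h T (by simp [hT]))
  constructor
  · have h := key (Finset.univ.filter fun S => DeterminedBy A S) (by simp)
    have e : (Finset.univ.filter fun S => DeterminedBy A S).inf id = vbl A := by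
      ext i
      simp [vbl, Finset.mem_inf]
    rw [e] at h
    exact h
  · intro S hS i hi
    exact (Finset.mem_filter.1 hi).2 S hS

/-- The dependency graph of a family of events: distinct events are adjacent when they depend on a
common variable. -/
def dependencyGraph (A : α → Set (∀ i, E i)) : SimpleGraph α where
  Adj a b := a ≠ b ∧ ¬ Disjoint (vbl (A a)) (vbl (A b))
  symm := ⟨fun _ _ h => ⟨h.1.symm, fun hd => h.2 hd.symm⟩⟩
  loopless := ⟨fun _ h => h.1 rfl⟩

open scoped Classical in
/-- `Γ(a)`: the neighbourhood of `a` in the dependency graph. -/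
noncomputable def neighbors [Fintype α] (A : α → Set (∀ i, E i)) (a : α) : Finset α :=
  Finset.univ.filter fun b => (dependencyGraph A).Adj a b

end Events

section Algorithm

variable {ι : Type*} {E : ι → Type*} {α : Type*}

/-- The memory of the algorithm: the current value of each variable, and the number of random
samples of each variable that have been drawn so far. -/
structure State (E : ι → Type*) where
  /-- the current value of each variable -/
  val : ∀ i, E i
  /-- how many samples of each variable have been drawn -/
  used : ι → ℕ

/-- Initialization: draw a sample of every variable. Here `src i k` is the `k`-th sample of the
variable `i` that the random source delivers. -/
def State.init (src : ∀ i, ℕ → E i) : State E where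
  val i := src i 0
  used _ := 1

open scoped Classical in
/-- Give each variable in `S` a new sample (the next unused one of the source), and keep the values
of the other variables. -/
noncomputable def State.resample (src : ∀ i, ℕ → E i) (S : Finset ι) (s : State E) : State E where
  val i := if i ∈ S then src i (s.used i) else s.val i
  used i := if i ∈ S then s.used i + 1 else s.used i

variable [Fintype ι]

/-- One step: if the event `a` is selected, resample the variables it depends on; if nothing is
selected (the algorithm has stopped), do nothing. -/
noncomputable def step (A : α → Set (∀ i, E i)) (src : ∀ i, ℕ → E i) :
    Option α → State E → State E
  | some a, s => s.resample src (vbl (A a))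
  | none, s => s

/-- The state before step `t` (steps are numbered from `0`) of the sequential resampling algorithm
with random source `src`, if `C s` is the event selected for resampling in step `s`, and
`C s = none` means that no event is selected in step `s`. -/
noncomputable def stateAt (A : α → Set (∀ i, E i)) (src : ∀ i, ℕ → E i) (C : ℕ → Option α) :
    ℕ → State E
  | 0 => State.init src
  | t + 1 => step A src (C t) (stateAt A src C t)

/-- What the algorithm may do at an evaluation `v`: select any violated event, or stop if no event
is violated. -/
def Allowed (A : α → Set (∀ i, E i)) (v : ∀ i, E i) : Option α → Prop
  | some a => v ∈ A a
  | none => ∀ a, v ∉ A a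

/-- `C` is the log of an execution of the sequential resampling algorithm with random source `src`:
as long as some event is violated, one (arbitrary) violated event is selected and resampled; as soon
as none is, the algorithm stops. -/
def IsLog (A : α → Set (∀ i, E i)) (src : ∀ i, ℕ → E i) (C : ℕ → Option α) : Prop :=
  ∀ t, Allowed A (stateAt A src C t).val (C t)

/-- A random execution, on the probability space `(Ω', ν)`, of the sequential resampling algorithm
for the variables `X i` on `(Ω, μ)` and the events `A a`. The random source delivers for each
variable `i` a sequence `src i 0, src i 1, …` of samples with the distribution of `X i`, all the
samples being mutually independent. The log `C` is random. Nothing is assumed about the way in which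
the violated events are selected: the choice may be deterministic or randomized, and may depend on
the whole history of the execution (indeed on anything). -/
structure IsExecution {Ω Ω' : Type*} [MeasurableSpace Ω] [MeasurableSpace Ω']
    [∀ i, MeasurableSpace (E i)] (μ : Measure Ω) (X : ∀ i, Ω → E i) (A : α → Set (∀ i, E i))
    (ν : Measure Ω') (src : ∀ i, ℕ → Ω' → E i) (C : ℕ → Ω' → Option α) : Prop where
  measurable_src : ∀ i k, Measurable (src i k)
  identDistrib_src : ∀ i k, IdentDistrib (src i k) (X i) ν μ
  indep_src : iIndepFun (fun p : ι × ℕ => src p.1 p.2) ν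
  measurableSet_log : ∀ t a, MeasurableSet {ω | C t ω = some a}
  isLog : ∀ ω, IsLog A (fun i k => src i k ω) (fun t => C t ω)

/-- How many times the event `a` is resampled according to the log `C` (possibly `∞`). -/
noncomputable def resampleCount (C : ℕ → Option α) (a : α) : ℝ≥0∞ :=
  ({t | C t = some a}.encard : ℝ≥0∞)

/-- The total number of resampling steps in the log `C` (possibly `∞`). -/
noncomputable def totalCount (C : ℕ → Option α) : ℝ≥0∞ :=
  ({t | C t ≠ none}.encard : ℝ≥0∞)

end Algorithm

end MoserTardos

/-! Existence is the classical local lemma: by induction on `S`, an event outside `S` has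
conditional probability at most `x a` given that nothing in `S` happens
(`measureReal_inter_avoid_le`).

For the algorithm, read the log backwards from a step that resamples `a` and sort the earlier steps
that influenced it into layers below `{a}`, each event just below the deepest layer with which it
shares a variable. The events of one layer have disjoint sets of variables, and each layer lies in
the closed neighbourhood of the one above. For an event in a layer, the number of deeper layers
containing a variable is the index of the sample of that variable which the event saw. So the list
of layers alone says which entries of the sample table make its events happen (`IsLog.witnessed`).
No entry is read twice; hence a fixed list is witnessed with probability at most the product of the
bounds `q b = x b * ∏ c ∈ neighbors A b, (1 - x c)` over its events (`measure_witnessTables_le`).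

Different resamplings of `a` give different lists, since the layers containing `a` count the earlier
resamplings of `a` (`countP_history`). The expected count is therefore at most the total weight of
all lists with top layer `{a}`. An induction on the length bounds the weight of the lists below `I`
by the product of `(1 - x b)⁻¹` over the closed neighbourhoods of the members of `I`
(`sum_weight_layerings_le`); for `I = {a}`, multiplying by `q a` leaves `x a / (1 - x a)`. -/

namespace MoserTardos

open scoped Classical

/-! ### Independence of events determined by disjoint sets of variables. -/

section Independence

variable {κ : Type*} {E : κ → Type*} [∀ k, MeasurableSpace (E k)]
  {Ω : Type*} [MeasurableSpace Ω] {ν : Measure Ω}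

/-- An event determined by the variables in `S` is a measurable event of their joint value. -/
theorem DeterminedBy.exists_preimage {B : Set (∀ k, E k)} (hB : MeasurableSet B) {S : Finset κ}
    (hS : DeterminedBy B S) (w : ∀ k, E k) :
    ∃ B' : Set (∀ k : S, E k), MeasurableSet B' ∧
      ∀ v : ∀ k, E k, v ∈ B ↔ (fun k : S => v k) ∈ B' := by
  let g : (∀ k : S, E k) → ∀ k, E k := fun v k => if h : k ∈ S then v ⟨k, h⟩ else w k
  have hg : Measurable g := by
    refine measurable_pi_iff.2 fun k => ?_
    by_cases h : k ∈ S
    · simpa [g, h] using measurable_pi_apply (⟨k, h⟩ : S)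
    · simp [g, h]
  exact ⟨g ⁻¹' B, hg hB, fun v => hS _ _ fun k hk => by simp [g, hk]⟩

theorem measure_inter_of_determinedBy {f : ∀ k, Ω → E k} (hf : ∀ k, Measurable (f k))
    (hind : iIndepFun f ν) {B B' : Set (∀ k, E k)} (hB : MeasurableSet B) (hB' : MeasurableSet B')
    {S T : Finset κ} (hS : DeterminedBy B S) (hT : DeterminedBy B' T) (hST : Disjoint S T) :
    ν {ω | (fun k => f k ω) ∈ B ∧ (fun k => f k ω) ∈ B'} =
      ν {ω | (fun k => f k ω) ∈ B} * ν {ω | (fun k => f k ω) ∈ B'} := by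
  -- A point of `Ω` supplies the values that complete a partial evaluation.
  rcases isEmpty_or_nonempty Ω with hΩ | ⟨⟨ω₀⟩⟩
  · simp [Measure.eq_zero_of_isEmpty ν]
  obtain ⟨D, hD, hBD⟩ := hS.exists_preimage hB fun k => f k ω₀
  obtain ⟨D', hD', hBD'⟩ := hT.exists_preimage hB' fun k => f k ω₀
  simp only [hBD, hBD']
  exact (hind.indepFun_finset S T hST hf).measure_inter_preimage_eq_mul _ _ hD hD'

end Independence

/-! ### The Lovász local lemma. -/

section LocalLemma

variable {ι : Type*} {E : ι → Type*} {α : Type*}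

/-- The evaluations that violate none of the events in `S`. -/
def avoid (A : α → Set (∀ i, E i)) (S : Finset α) : Set (∀ i, E i) := {v | ∀ b ∈ S, v ∉ A b}

theorem measurableSet_avoid [∀ i, MeasurableSpace (E i)] {A : α → Set (∀ i, E i)}
    (hA : ∀ a, MeasurableSet (A a)) (S : Finset α) : MeasurableSet (avoid A S) := by
  have : avoid A S = ⋂ b ∈ S, (A b)ᶜ := by ext; simp [avoid]
  rw [this]
  exact S.measurableSet_biInter fun b _ => (hA b).compl

/-- The conditional bounds are kept multiplied out, so that no conditioning event has to be shown
non-null. -/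
theorem one_sub_mul_measureReal_avoid_le [∀ i, MeasurableSpace (E i)]
    {Ω : Type*} [MeasurableSpace Ω]
    {μ : Measure Ω} [IsProbabilityMeasure μ] {X : ∀ i, Ω → E i} {A : α → Set (∀ i, E i)} {x : α → ℝ}
    (hX : ∀ i, Measurable (X i))
    (hA : ∀ a, MeasurableSet (A a)) {S : Finset α} {a : α}
    (h : μ.real {ω | (fun i => X i ω) ∈ A a ∧ (fun i => X i ω) ∈ avoid A S} ≤
      x a * μ.real {ω | (fun i => X i ω) ∈ avoid A S}) :
    (1 - x a) * μ.real {ω | (fun i => X i ω) ∈ avoid A S} ≤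
      μ.real {ω | (fun i => X i ω) ∈ avoid A (insert a S)} := by
  have hm : MeasurableSet {ω | (fun i => X i ω) ∈ A a} := measurable_pi_iff.2 hX (hA a)
  have := measureReal_inter_add_sdiff (μ := μ) (s := {ω | (fun i => X i ω) ∈ avoid A S}) hm
  have e1 : {ω | (fun i => X i ω) ∈ avoid A S} ∩ {ω | (fun i => X i ω) ∈ A a} =
      {ω | (fun i => X i ω) ∈ A a ∧ (fun i => X i ω) ∈ avoid A S} := by
    ext; simp [and_comm]
  have e2 : {ω | (fun i => X i ω) ∈ avoid A S} \ {ω | (fun i => X i ω) ∈ A a} =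
      {ω | (fun i => X i ω) ∈ avoid A (insert a S)} := by
    ext; simp [avoid, and_comm]
  rw [e1, e2] at this
  linarith

variable [Fintype ι]

theorem determinedBy_vbl (B : Set (∀ i, E i)) : DeterminedBy B (vbl B) := (isLeast_vbl B).1

theorem determinedBy_avoid (A : α → Set (∀ i, E i)) (S : Finset α) :
    DeterminedBy (avoid A S) (S.biUnion fun b => vbl (A b)) := fun v w h =>
  forall₂_congr fun b hb => not_congr <| determinedBy_vbl (A b) v w fun i hi =>
    h i (Finset.mem_biUnion.2 ⟨b, hb, hi⟩)

theorem mem_neighbors [Fintype α] {A : α → Set (∀ i, E i)} {a b : α} :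
    b ∈ neighbors A a ↔ a ≠ b ∧ ¬ Disjoint (vbl (A a)) (vbl (A b)) := by
  rw [neighbors, Finset.mem_filter]
  simp [dependencyGraph]

variable [∀ i, MeasurableSpace (E i)]
  {Ω : Type*} [MeasurableSpace Ω] {μ : Measure Ω} [IsProbabilityMeasure μ]
  {X : ∀ i, Ω → E i} {A : α → Set (∀ i, E i)} {x : α → ℝ}

variable [Fintype α]

/-- Split `S` into neighbours `V` and non-neighbours `U` of `a`. Avoiding `U` is independent of `A
a`; passing from `U` to `S` costs at most the factors `1 - x b` for `b ∈ V`, which the hypothesis on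
`A a` provides. -/
theorem measureReal_inter_avoid_le (hX : ∀ i, Measurable (X i)) (hind : iIndepFun X μ)
    (hA : ∀ a, MeasurableSet (A a)) (hx : ∀ a, x a ∈ Set.Ioo (0 : ℝ) 1)
    (hLLL : ∀ a, μ.real {ω | (fun i => X i ω) ∈ A a} ≤ x a * ∏ b ∈ neighbors A a, (1 - x b))
    (S : Finset α) : ∀ a ∉ S,
    μ.real {ω | (fun i => X i ω) ∈ A a ∧ (fun i => X i ω) ∈ avoid A S} ≤
      x a * μ.real {ω | (fun i => X i ω) ∈ avoid A S} := by
  induction S using Finset.strongInduction with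
  | H S ih =>
  intro a ha
  set U := S.filter (· ∉ neighbors A a)
  set V := S.filter (· ∈ neighbors A a)
  have hVU : V ∪ U = S := Finset.filter_union_filter_not_eq _ _
  -- The neighbours are added one at a time. The induction hypothesis applies to `T ∪ U` because the
  -- next neighbour `b ∈ S` is still missing from it.
  have chain : ∀ T ⊆ V, (∏ b ∈ T, (1 - x b)) * μ.real {ω | (fun i => X i ω) ∈ avoid A U} ≤
      μ.real {ω | (fun i => X i ω) ∈ avoid A (T ∪ U)} := by
    intro T
    induction T using Finset.induction_on with
    | empty => simp
    | insert b T hb ihT =>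
      intro hT
      have hbV : b ∈ V := hT (Finset.mem_insert_self _ _)
      have hbU : b ∉ T ∪ U := by
        simp only [Finset.mem_union, not_or, hb, not_false_iff, true_and]
        exact fun h => (Finset.mem_filter.1 h).2 (Finset.mem_filter.1 hbV).2
      have hTV : T ⊆ V := (Finset.subset_insert _ _).trans hT
      have hss : T ∪ U ⊂ S := by
        refine (Finset.ssubset_iff_of_subset ?_).2 ⟨b, (Finset.mem_filter.1 hbV).1, hbU⟩
        rw [← hVU]
        exact Finset.union_subset_union_left hTV
      have h1 := one_sub_mul_measureReal_avoid_le hX hA (ih _ hss b hbU)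
      rw [Finset.prod_insert hb, Finset.insert_union, mul_assoc]
      exact (mul_le_mul_of_nonneg_left (ihT hTV) (by linarith [(hx b).2])).trans h1
  have hdisj : Disjoint (vbl (A a)) (U.biUnion fun b => vbl (A b)) := by
    refine (Finset.disjoint_biUnion_right _ _ _).2 fun b hb => ?_
    obtain ⟨hbS, hbn⟩ := Finset.mem_filter.1 hb
    by_contra h
    exact hbn (mem_neighbors.2 ⟨fun e => ha (e ▸ hbS), h⟩)
  have hmul : μ.real {ω | (fun i => X i ω) ∈ A a ∧ (fun i => X i ω) ∈ avoid A U} =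
      μ.real {ω | (fun i => X i ω) ∈ A a} * μ.real {ω | (fun i => X i ω) ∈ avoid A U} := by
    simp only [measureReal_def]
    rw [measure_inter_of_determinedBy hX hind (hA a) (measurableSet_avoid hA U)
      (determinedBy_vbl _) (determinedBy_avoid A U) hdisj, ENNReal.toReal_mul]
  have hprod : ∏ b ∈ neighbors A a, (1 - x b) ≤ ∏ b ∈ V, (1 - x b) :=
    Finset.prod_le_prod_of_subset_of_le_one (fun b hb => (Finset.mem_filter.1 hb).2)
      (fun b _ => by linarith [(hx b).2]) (fun b _ _ => by linarith [(hx b).1])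
  calc μ.real {ω | (fun i => X i ω) ∈ A a ∧ (fun i => X i ω) ∈ avoid A S}
      ≤ μ.real {ω | (fun i => X i ω) ∈ A a ∧ (fun i => X i ω) ∈ avoid A U} :=
        measureReal_mono fun ω h => ⟨h.1, fun b hb => h.2 b (Finset.mem_filter.1 hb).1⟩
    _ ≤ x a * (∏ b ∈ V, (1 - x b)) * μ.real {ω | (fun i => X i ω) ∈ avoid A U} := by
        rw [hmul]
        exact mul_le_mul_of_nonneg_right ((hLLL a).trans
          (mul_le_mul_of_nonneg_left hprod (hx a).1.le)) measureReal_nonneg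
    _ ≤ x a * μ.real {ω | (fun i => X i ω) ∈ avoid A S} := by
        rw [mul_assoc]
        exact mul_le_mul_of_nonneg_left (hVU ▸ chain V subset_rfl) (hx a).1.le

/-- The Lovász local lemma for events determined by independent variables. -/
theorem prod_one_sub_le_measureReal_avoid (hX : ∀ i, Measurable (X i)) (hind : iIndepFun X μ)
    (hA : ∀ a, MeasurableSet (A a)) (hx : ∀ a, x a ∈ Set.Ioo (0 : ℝ) 1)
    (hLLL : ∀ a, μ.real {ω | (fun i => X i ω) ∈ A a} ≤ x a * ∏ b ∈ neighbors A a, (1 - x b))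
    (S : Finset α) : ∏ b ∈ S, (1 - x b) ≤ μ.real {ω | (fun i => X i ω) ∈ avoid A S} := by
  induction S using Finset.induction_on with
  | empty => simp [avoid]
  | insert a S ha ih =>
    rw [Finset.prod_insert ha]
    exact (mul_le_mul_of_nonneg_left ih (by linarith [(hx a).2])).trans
      (one_sub_mul_measureReal_avoid_le hX hA
        (measureReal_inter_avoid_le hX hind hA hx hLLL S a ha))

theorem exists_forall_notMem (hX : ∀ i, Measurable (X i)) (hind : iIndepFun X μ)
    (hA : ∀ a, MeasurableSet (A a)) (hx : ∀ a, x a ∈ Set.Ioo (0 : ℝ) 1)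
    (hLLL : ∀ a, μ.real {ω | (fun i => X i ω) ∈ A a} ≤ x a * ∏ b ∈ neighbors A a, (1 - x b)) :
    ∃ ω, ∀ a, (fun i => X i ω) ∉ A a := by
  have h := prod_one_sub_le_measureReal_avoid hX hind hA hx hLLL Finset.univ
  have hpos : (0 : ℝ) < ∏ b : α, (1 - x b) := Finset.prod_pos fun b _ => by linarith [(hx b).2]
  by_contra! hne
  have : {ω | (fun i => X i ω) ∈ avoid A Finset.univ} = ∅ := by
    ext ω
    simpa [avoid] using hne ω
  rw [this, measureReal_empty] at h
  linarith

end LocalLemma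

/-! ### Layers of the causal past, and the samples they read. -/

section Layers

variable {ι : Type*} [Fintype ι] {E : ι → Type*} {α : Type*} (A : α → Set (∀ i, E i))

/-- The event `c` depends on a variable on which some event of `J` depends. -/
def Touches (c : α) (J : Finset α) : Prop := ∃ b ∈ J, ¬ Disjoint (vbl (A b)) (vbl (A c))

/-- Given the list of layers `J :: L`, put `c` into the layer just after the last one that `c`
touches, and return the part of the new list after `J`. If `c` touches no layer, it is discarded. -/
noncomputable def below (c : α) : Finset α → List (Finset α) → List (Finset α)
  | J, [] => if Touches A c J then [{c}] else []
  | J, K :: L =>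
    if ∃ M ∈ K :: L, Touches A c M then K :: below c K L
    else if Touches A c J then insert c K :: L else K :: L

/-- The number of layers in which the variable `i` occurs. -/
noncomputable def depth : List (Finset α) → ι → ℕ
  | [], _ => 0
  | J :: L, i => depth L i + if ∃ b ∈ J, i ∈ vbl (A b) then 1 else 0

/-- All events in the layers happen, if the variables of the deepest layer are read from position `u`
of the source, and each layer that contains a variable uses up one sample of it. -/
def Witnessed (src : ∀ i, ℕ → E i) (u : ι → ℕ) : List (Finset α) → Prop
  | [] => True
  | J :: L => (∀ b ∈ J, (fun i => src i (u i + depth A L i)) ∈ A b) ∧ Witnessed src u L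

/-- The layers below `J` of the causal past of a step at time `t` of the log `C`, if `L` are the
layers that come from the steps from `t` on. -/
noncomputable def history (C : ℕ → Option α) (J : Finset α) :
    ℕ → List (Finset α) → List (Finset α)
  | 0, L => L
  | t + 1, L => history C J t ((C t).elim L fun c => below A c J L)

/-- How often each variable is resampled before step `t` of the log `C`. -/
noncomputable def cursor (C : ℕ → Option α) : ℕ → ι → ℕ
  | 0, _ => 0
  | t + 1, i => cursor C t i + if ∃ c, C t = some c ∧ i ∈ vbl (A c) then 1 else 0

variable {A}

theorem touches_of_mem {c : α} {J : Finset α} (hc : (vbl (A c)).Nonempty) (h : c ∈ J) :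
    Touches A c J := ⟨c, h, by simpa [Finset.disjoint_self_iff_empty] using hc.ne_empty⟩

theorem notMem_vbl_of_not_touches {c : α} {J : Finset α} (h : ¬ Touches A c J) {b : α} (hb : b ∈ J)
    {i : ι} (hi : i ∈ vbl (A b)) : i ∉ vbl (A c) := fun hic =>
  h ⟨b, hb, Finset.not_disjoint_iff.2 ⟨i, hi, hic⟩⟩

theorem depth_eq_zero {c : α} {L : List (Finset α)} (h : ∀ J ∈ L, ¬ Touches A c J) {i : ι}
    (hi : i ∈ vbl (A c)) : depth A L i = 0 := by
  induction L with
  | nil => rfl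
  | cons J L ih =>
    have : ¬ ∃ b ∈ J, i ∈ vbl (A b) := fun ⟨b, hb, hib⟩ =>
      notMem_vbl_of_not_touches (h J (by simp)) hb hib hi
    simp [depth, this, ih fun K hK => h K (by simp [hK])]

theorem below_of_not_touches {c : α} {J : Finset α} {L : List (Finset α)}
    (h : ∀ M ∈ J :: L, ¬ Touches A c M) : below A c J L = L := by
  have hJ := h J (by simp)
  cases L with
  | nil => simp [below, hJ]
  | cons K L =>
    have : ¬ ∃ M ∈ K :: L, Touches A c M := fun ⟨M, hM, hc⟩ => h M (by simp [hM]) hc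
    rw [below, if_neg this, if_neg hJ]

/-- The layer that receives `c` was not touched by `c`, so each variable of `c` gains exactly one
layer there. -/
theorem depth_below {c : α} {J : Finset α} {L : List (Finset α)}
    (h : ∃ M ∈ J :: L, Touches A c M) (i : ι) :
    depth A (below A c J L) i = depth A L i + if i ∈ vbl (A c) then 1 else 0 := by
  induction L generalizing J with
  | nil =>
    have hJ : Touches A c J := by simpa using h
    simp [below, hJ, depth]
  | cons K L ih =>
    by_cases hd : ∃ M ∈ K :: L, Touches A c M
    · rw [below, if_pos hd, depth, depth, ih hd]
      omega
    · have hJ : Touches A c J := by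
        obtain ⟨M, hM, hc⟩ := h
        rcases List.mem_cons.1 hM with rfl | hM
        · exact hc
        · exact absurd ⟨M, hM, hc⟩ hd
      rw [below, if_neg hd, if_pos hJ, depth, depth]
      have hK : ¬ Touches A c K := fun hc => hd ⟨K, by simp, hc⟩
      by_cases hi : i ∈ vbl (A c)
      · have : ¬ ∃ b ∈ K, i ∈ vbl (A b) := fun ⟨b, hb, hib⟩ =>
          notMem_vbl_of_not_touches hK hb hib hi
        simp [hi, this]
      · simp [hi]

/-- Having a variable, `a` touches every layer that contains it, so it is always put into a layer
where it does not yet occur. -/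
theorem countP_below_self {a : α} (ha : (vbl (A a)).Nonempty) {J : Finset α}
    {L : List (Finset α)} (h : ∃ M ∈ J :: L, Touches A a M) :
    (below A a J L).countP (fun K => a ∈ K) = L.countP (fun K => a ∈ K) + 1 := by
  induction L generalizing J with
  | nil =>
    have hJ : Touches A a J := by simpa using h
    simp [below, hJ]
  | cons K L ih =>
    by_cases hd : ∃ M ∈ K :: L, Touches A a M
    · rw [below, if_pos hd, List.countP_cons, List.countP_cons, ih hd]
      omega
    · have hJ : Touches A a J := by
        obtain ⟨M, hM, hc⟩ := h
        rcases List.mem_cons.1 hM with rfl | hM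
        · exact hc
        · exact absurd ⟨M, hM, hc⟩ hd
      have hK : a ∉ K := fun hc => hd ⟨K, by simp, touches_of_mem ha hc⟩
      rw [below, if_neg hd, if_pos hJ, List.countP_cons, List.countP_cons]
      simp [hK]

theorem countP_below_of_ne {a c : α} (hac : a ≠ c) (J : Finset α) (L : List (Finset α)) :
    (below A c J L).countP (fun K => a ∈ K) = L.countP (fun K => a ∈ K) := by
  induction L generalizing J with
  | nil => by_cases hJ : Touches A c J <;> simp [below, hJ, hac]
  | cons K L ih =>
    rw [below]
    split_ifs
    · rw [List.countP_cons, List.countP_cons, ih]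
    · simp [List.countP_cons, hac]
    · rfl

theorem countP_history {a : α} (ha : (vbl (A a)).Nonempty) (C : ℕ → Option α) (t : ℕ)
    (L : List (Finset α)) : (history A C {a} t L).countP (fun K => a ∈ K) =
      L.countP (fun K => a ∈ K) + Nat.count (fun s => C s = some a) t := by
  induction t generalizing L with
  | zero => simp [history]
  | succ t ih =>
    rw [history, ih, Nat.count_succ]
    cases hC : C t with
    | none => simp
    | some c =>
      by_cases hac : a = c
      · subst hac
        rw [Option.elim_some,
          countP_below_self ha ⟨{a}, by simp, touches_of_mem ha (by simp)⟩, if_pos rfl]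
        omega
      · rw [Option.elim_some, countP_below_of_ne hac, if_neg fun h => hac (Option.some.inj h).symm,
          add_zero]

theorem witnessed_congr {src : ∀ i, ℕ → E i} {c : α} {L : List (Finset α)}
    (h : ∀ J ∈ L, ¬ Touches A c J) {u u' : ι → ℕ} (hu : ∀ i ∉ vbl (A c), u i = u' i) :
    Witnessed A src u L ↔ Witnessed A src u' L := by
  induction L with
  | nil => rfl
  | cons J L ih =>
    rw [Witnessed, Witnessed, ih fun K hK => h K (by simp [hK])]
    refine and_congr_left fun _ => forall₂_congr fun b hb => determinedBy_vbl _ _ _ fun i hi => ?_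
    rw [hu i (notMem_vbl_of_not_touches (h J (by simp)) hb hi)]

/-- Undoing the step of `c` lowers the base position of its variables by one. At and above the
deepest touched layer the added depth compensates for this; the layers further down read no variable
of `c`. -/
theorem witnessed_below {src : ∀ i, ℕ → E i} {c : α} {u u' : ι → ℕ}
    (hc : (fun i => src i (u i)) ∈ A c) (hu : ∀ i, u' i = u i + if i ∈ vbl (A c) then 1 else 0)
    {J : Finset α} {L : List (Finset α)} (h : Witnessed A src u' (J :: L)) :
    Witnessed A src u (J :: below A c J L) := by
  have hu' : ∀ i ∉ vbl (A c), u i = u' i := fun i hi => by simp [hu, hi]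
  by_cases ht : ∃ M ∈ J :: L, Touches A c M
  swap
  · push Not at ht
    rw [below_of_not_touches ht]
    exact (witnessed_congr ht hu').2 h
  refine ⟨fun b hb => ?_, ?_⟩
  · have h1 := h.1 b hb
    have e : ∀ i, u i + depth A (below A c J L) i = u' i + depth A L i := fun i => by
      rw [depth_below ht, hu]; omega
    simpa only [e] using h1
  replace h := h.2
  induction L generalizing J with
  | nil =>
    have hJ : Touches A c J := by simpa using ht
    simpa [below, hJ, Witnessed, depth] using hc
  | cons K L ih =>
    by_cases hd : ∃ M ∈ K :: L, Touches A c M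
    · rw [below, if_pos hd]
      refine ⟨fun b hb => ?_, ih hd h.2⟩
      have h1 := h.1 b hb
      have e : ∀ i, u i + depth A (below A c K L) i = u' i + depth A L i := fun i => by
        rw [depth_below hd, hu]; omega
      simpa only [e] using h1
    · have hJ : Touches A c J := by
        obtain ⟨M, hM, hc⟩ := ht
        rcases List.mem_cons.1 hM with rfl | hM
        · exact hc
        · exact absurd ⟨M, hM, hc⟩ hd
      push Not at hd
      have h2 := (witnessed_congr hd hu').2 h
      rw [below, if_neg (by push Not; exact hd), if_pos hJ]
      refine ⟨fun b hb => ?_, h2.2⟩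
      -- No layer of `L` contains a variable of `c`, so `c` reads exactly the samples at `u`, where
      -- it happens by `hc`.
      rcases Finset.mem_insert.1 hb with rfl | hb
      · refine (determinedBy_vbl _ _ _ fun i hi => ?_).1 hc
        rw [depth_eq_zero (fun M hM => hd M (by simp [hM])) hi, add_zero]
      · exact h2.1 b hb

theorem witnessed_history {src : ∀ i, ℕ → E i} {C : ℕ → Option α}
    (hC : ∀ s c, C s = some c → (fun i => src i (cursor A C s i)) ∈ A c) {J : Finset α} {t : ℕ}
    {L : List (Finset α)} (h : Witnessed A src (cursor A C t) (J :: L)) :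
    Witnessed A src 0 (J :: history A C J t L) := by
  induction t generalizing L with
  | zero => exact h
  | succ t ih =>
    refine ih ?_
    cases hc : C t with
    | none =>
      have : cursor A C (t + 1) = cursor A C t := by ext i; simp [cursor, hc]
      rwa [this] at h
    | some c => exact witnessed_below (hC t c hc) (fun i => by simp [cursor, hc]) h

/-- Initialization already uses the sample of index `0`, hence the shift by one between the current
index and the number of samples drawn. -/
theorem stateAt_eq (src : ∀ i, ℕ → E i) (C : ℕ → Option α) (t : ℕ) (i : ι) :
    (stateAt A src C t).val i = src i (cursor A C t i) ∧
      (stateAt A src C t).used i = cursor A C t i + 1 := by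
  induction t with
  | zero => exact ⟨rfl, rfl⟩
  | succ t ih =>
    rw [stateAt]
    cases hc : C t with
    | none => simpa [step, cursor, hc] using ih
    | some c => by_cases hi : i ∈ vbl (A c) <;> simp [step, State.resample, cursor, hc, hi, ih]

theorem IsLog.mem {src : ∀ i, ℕ → E i} {C : ℕ → Option α} (h : IsLog A src C) {t : ℕ} {c : α}
    (hc : C t = some c) : (fun i => src i (cursor A C t i)) ∈ A c := by
  have h1 := h t
  rw [hc] at h1
  have e : (stateAt A src C t).val = fun i => src i (cursor A C t i) :=
    funext fun i => (stateAt_eq src C t i).1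
  rwa [Allowed, e] at h1

theorem IsLog.witnessed {src : ∀ i, ℕ → E i} {C : ℕ → Option α} (h : IsLog A src C) {t : ℕ} {a : α}
    (ha : C t = some a) : Witnessed A src 0 ({a} :: history A C {a} t []) :=
  witnessed_history (fun _ _ => h.mem) ⟨by simpa [depth] using h.mem ha, trivial⟩

/-! ### The combinatorial shape of the lists of layers. -/

variable [Fintype α] (A)

/-- The events that are equal or adjacent to some event in `I`. -/
noncomputable def closedNeighbors (I : Finset α) : Finset α :=
  I.biUnion fun a => insert a (neighbors A a)

/-- `L` is a list of layers that can occur below the layer `I`. -/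
def IsLayered : Finset α → List (Finset α) → Prop
  | _, [] => True
  | I, J :: L => J.Nonempty ∧ J ⊆ closedNeighbors A I ∧
      (J : Set α).PairwiseDisjoint (fun b => vbl (A b)) ∧ IsLayered J L

variable {A}

theorem mem_closedNeighbors_of_touches {c : α} {J : Finset α} (h : Touches A c J) :
    c ∈ closedNeighbors A J := by
  obtain ⟨b, hb, hbc⟩ := h
  refine Finset.mem_biUnion.2 ⟨b, hb, ?_⟩
  by_cases e : b = c
  · simp [e]
  · exact Finset.mem_insert_of_mem (mem_neighbors.2 ⟨e, hbc⟩)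

theorem IsLayered.mono {I I' : Finset α} (hI : I ⊆ I') {L : List (Finset α)}
    (h : IsLayered A I L) : IsLayered A I' L := by
  cases L with
  | nil => trivial
  | cons J L =>
    exact ⟨h.1, h.2.1.trans (Finset.biUnion_subset_biUnion_of_subset_left _ hI), h.2.2⟩

theorem IsLayered.below {c : α} {J : Finset α} {L : List (Finset α)} (h : IsLayered A J L) :
    IsLayered A J (below A c J L) := by
  induction L generalizing J with
  | nil =>
    by_cases hJ : Touches A c J
    · simpa [MoserTardos.below, hJ, IsLayered] using mem_closedNeighbors_of_touches hJ
    · simp [MoserTardos.below, hJ, IsLayered]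
  | cons K L ih =>
    rw [MoserTardos.below]
    split_ifs with hd hJ
    · exact ⟨h.1, h.2.1, h.2.2.1, ih h.2.2.2⟩
    · refine ⟨Finset.insert_nonempty _ _,
        Finset.insert_subset (mem_closedNeighbors_of_touches hJ) h.2.1, ?_,
        h.2.2.2.mono (Finset.subset_insert _ _)⟩
      -- `c` touches no layer from `K` on, so it shares no variable with the members of `K`.
      rw [Finset.coe_insert]
      refine h.2.2.1.insert fun b hb _ => ?_
      by_contra hcb
      exact hd ⟨K, by simp, b, hb, fun h => hcb h.symm⟩
    · exact h

theorem IsLayered.history {C : ℕ → Option α} {J : Finset α} {t : ℕ} {L : List (Finset α)}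
    (h : IsLayered A J L) : IsLayered A J (history A C J t L) := by
  induction t generalizing L with
  | zero => exact h
  | succ t ih =>
    refine ih ?_
    cases C t with
    | none => exact h
    | some c => exact h.below

end Layers

/-! ### The total weight of all lists of layers. -/

section Weights

/-- The product of the weights of the events in all layers. -/
def weight {α : Type*} (q : α → ℝ) : List (Finset α) → ℝ
  | [] => 1
  | J :: L => (∏ b ∈ J, q b) * weight q L

theorem weight_nonneg {α : Type*} {q : α → ℝ} (hq : ∀ a, 0 ≤ q a) (L : List (Finset α)) :
    0 ≤ weight q L := by
  induction L with
  | nil => exact zero_le_one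
  | cons J L ih => exact mul_nonneg (Finset.prod_nonneg fun b _ => hq b) ih

/-- Counting a factor that is at least `1` several times can only increase the product. -/
theorem prod_biUnion_le_prod_prod {α β : Type*} {f : β → ℝ} (hf : ∀ b, 1 ≤ f b) (I : Finset α)
    (t : α → Finset β) : ∏ b ∈ I.biUnion t, f b ≤ ∏ a ∈ I, ∏ b ∈ t a, f b := by
  have hpos : ∀ s : Finset β, 1 ≤ ∏ b ∈ s, f b := fun s => Finset.one_le_prod fun b _ => hf b
  induction I using Finset.induction_on with
  | empty => simp
  | insert a I ha ih =>
    rw [Finset.biUnion_insert, Finset.prod_insert ha]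
    calc ∏ b ∈ t a ∪ I.biUnion t, f b
        ≤ (∏ b ∈ t a ∪ I.biUnion t, f b) * ∏ b ∈ t a ∩ I.biUnion t, f b :=
          le_mul_of_one_le_right (zero_le_one.trans (hpos _)) (hpos _)
      _ = (∏ b ∈ t a, f b) * ∏ b ∈ I.biUnion t, f b := Finset.prod_union_inter
      _ ≤ _ := mul_le_mul_of_nonneg_left ih (zero_le_one.trans (hpos _))

variable {ι : Type*} [Fintype ι] {E : ι → Type*} {α : Type*} [Fintype α]
  (A : α → Set (∀ i, E i))

/-- The lists of at most `n` nonempty layers, each in the closed neighbourhood of its predecessor,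
that can occur below the layer `I`. -/
noncomputable def layerings : ℕ → Finset α → Finset (List (Finset α))
  | 0, _ => {[]}
  | n + 1, I => insert [] (((closedNeighbors A I).powerset.erase ∅).biUnion fun J =>
      (layerings n J).image (List.cons J))

variable {A}

theorem IsLayered.mem_layerings {n : ℕ} {I : Finset α} {L : List (Finset α)}
    (h : IsLayered A I L) (hn : L.length ≤ n) : L ∈ layerings A n I := by
  induction n generalizing I L with
  | zero => simpa [layerings] using hn
  | succ n ih =>
    cases L with
    | nil => exact Finset.mem_insert_self _ _
    | cons J L =>
      refine Finset.mem_insert_of_mem (Finset.mem_biUnion.2 ⟨J, ?_, Finset.mem_image_of_mem _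
        (ih h.2.2.2 (by simpa using hn))⟩)
      exact Finset.mem_erase.2 ⟨h.1.ne_empty, Finset.mem_powerset.2 h.2.1⟩

theorem mul_prod_inv_one_sub_eq {x : α → ℝ} (hx : ∀ a, x a ∈ Set.Ioo (0 : ℝ) 1) (a : α) :
    (x a * ∏ b ∈ neighbors A a, (1 - x b)) * ∏ b ∈ insert a (neighbors A a), (1 - x b)⁻¹ =
      x a / (1 - x a) := by
  have h0 : ∏ b ∈ neighbors A a, (1 - x b) ≠ 0 :=
    Finset.prod_ne_zero_iff.2 fun b _ => by linarith [(hx b).2]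
  rw [Finset.prod_insert fun h => (mem_neighbors.1 h).1 rfl, Finset.prod_inv_distrib]
  field_simp

/-- Once the lists below the first layer `J` are summed, `J` contributes at most `∏ b ∈ J, x b / (1
- x b)`. Summing over all subsets `J` of the closed neighbourhood factorizes, because `1 + x b / (1
- x b) = (1 - x b)⁻¹`. Disjointness within layers is not needed for this upper bound. -/
theorem sum_weight_layerings_le {x : α → ℝ} (hx : ∀ a, x a ∈ Set.Ioo (0 : ℝ) 1) (n : ℕ)
    (I : Finset α) :
    ∑ L ∈ layerings A n I, weight (fun a => x a * ∏ b ∈ neighbors A a, (1 - x b)) L ≤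
      ∏ a ∈ I, ∏ b ∈ insert a (neighbors A a), (1 - x b)⁻¹ := by
  set q : α → ℝ := fun a => x a * ∏ b ∈ neighbors A a, (1 - x b)
  have hq0 : ∀ a, 0 ≤ q a := fun a => mul_nonneg (hx a).1.le
    (Finset.prod_nonneg fun b _ => by linarith [(hx b).2])
  have h1 : ∀ b, 1 ≤ (1 - x b)⁻¹ := fun b =>
    (one_le_inv₀ (by linarith [(hx b).2])).2 (by linarith [(hx b).1])
  induction n generalizing I with
  | zero =>
    simp only [layerings, Finset.sum_singleton, weight]
    exact Finset.one_le_prod fun a _ => Finset.one_le_prod fun b _ => h1 b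
  | succ n ih =>
    have hcons : ∀ J ∈ (closedNeighbors A I).powerset.erase ∅,
        ∑ L ∈ (layerings A n J).image (List.cons J), weight q L ≤ ∏ b ∈ J, x b / (1 - x b) := by
      intro J _
      rw [Finset.sum_image (List.cons_injective.injOn)]
      simp only [weight]
      rw [← Finset.mul_sum]
      refine (mul_le_mul_of_nonneg_left (ih J) (Finset.prod_nonneg fun b _ => hq0 b)).trans_eq ?_
      rw [← Finset.prod_mul_distrib]
      exact Finset.prod_congr rfl fun b _ => mul_prod_inv_one_sub_eq hx b
    have hdisj : ((((closedNeighbors A I).powerset.erase ∅ : Finset (Finset α)) :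
        Set (Finset α))).PairwiseDisjoint fun J => (layerings A n J).image (List.cons J) := by
      intro J _ K _ hJK
      refine Finset.disjoint_left.2 fun L hL hL' => hJK ?_
      obtain ⟨M, _, rfl⟩ := Finset.mem_image.1 hL
      obtain ⟨N, _, hN⟩ := Finset.mem_image.1 hL'
      exact (List.cons.inj hN).1.symm
    rw [layerings, Finset.sum_insert (by simp), Finset.sum_biUnion hdisj, weight]
    calc 1 + ∑ J ∈ (closedNeighbors A I).powerset.erase ∅,
          ∑ L ∈ (layerings A n J).image (List.cons J), weight q L
        ≤ 1 + ∑ J ∈ (closedNeighbors A I).powerset.erase ∅, ∏ b ∈ J, x b / (1 - x b) :=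
          add_le_add_right (Finset.sum_le_sum hcons) _
      -- The `1` from the empty list plays the role of the missing term `J = ∅`.
      _ = ∑ J ∈ (closedNeighbors A I).powerset, ∏ b ∈ J, x b / (1 - x b) := by
          rw [← Finset.add_sum_erase _ _ (Finset.empty_mem_powerset _), Finset.prod_empty]
      _ = ∏ b ∈ closedNeighbors A I, (1 - x b)⁻¹ := by
          rw [← Finset.prod_one_add]
          refine Finset.prod_congr rfl fun b _ => ?_
          have : 1 - x b ≠ 0 := by linarith [(hx b).2]
          field_simp
          ring
      _ ≤ _ := prod_biUnion_le_prod_prod h1 I _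

end Weights

/-! ### Probability that a list of layers is witnessed. -/

section Probability

variable {ι : Type*} {E : ι → Type*} {α : Type*}

/-- The tables of samples for which `b` happens at the samples of index `u`. -/
def eventTables (A : α → Set (∀ i, E i)) (u : ι → ℕ) (b : α) : Set (∀ p : ι × ℕ, E p.1) :=
  {τ | (fun i => τ (i, u i)) ∈ A b}

theorem measurableSet_eventTables {A : α → Set (∀ i, E i)} [∀ i, MeasurableSpace (E i)]
    (hA : ∀ a, MeasurableSet (A a)) (u : ι → ℕ) (b : α) :
    MeasurableSet (eventTables A u b) :=
  measurable_pi_iff.2 (fun i => measurable_pi_apply (i, u i)) (hA b)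

theorem measurableSet_layerTables {A : α → Set (∀ i, E i)} [∀ i, MeasurableSpace (E i)]
    (hA : ∀ a, MeasurableSet (A a)) (u : ι → ℕ) (J : Finset α)
    {B : Set (∀ p : ι × ℕ, E p.1)} (hB : MeasurableSet B) :
    MeasurableSet {τ | (∀ b ∈ J, τ ∈ eventTables A u b) ∧ τ ∈ B} := by
  have : {τ | (∀ b ∈ J, τ ∈ eventTables A u b) ∧ τ ∈ B} =
      (⋂ b ∈ J, eventTables A u b) ∩ B := by ext; simp
  rw [this]
  exact (J.measurableSet_biInter fun b _ => measurableSet_eventTables hA u b).inter hB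

variable [Fintype ι]

/-- The positions of the random source on which `Witnessed A · 0 L` depends. -/
noncomputable def positions (A : α → Set (∀ i, E i)) (L : List (Finset α)) : Finset (ι × ℕ) :=
  Finset.univ.biUnion fun i => (Finset.range (depth A L i)).image (Prod.mk i)

/-- The tables of samples for which all events in the layers `L` happen. -/
def witnessTables (A : α → Set (∀ i, E i)) (L : List (Finset α)) : Set (∀ p : ι × ℕ, E p.1) :=
  {τ | Witnessed A (fun i k => τ (i, k)) 0 L}

variable {A : α → Set (∀ i, E i)}

theorem mem_positions {L : List (Finset α)} {p : ι × ℕ} :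
    p ∈ positions A L ↔ p.2 < depth A L p.1 := by
  obtain ⟨i, k⟩ := p
  simp [positions]

theorem determinedBy_eventTables (u : ι → ℕ) (b : α) :
    DeterminedBy (eventTables A u b) ((vbl (A b)).image fun i => (i, u i)) := fun _ _ h =>
  determinedBy_vbl (A b) _ _ fun i hi => h (i, u i) (Finset.mem_image_of_mem _ hi)

theorem witnessTables_cons (J : Finset α) (L : List (Finset α)) :
    witnessTables A (J :: L) =
      {τ | (∀ b ∈ J, τ ∈ eventTables A (depth A L) b) ∧ τ ∈ witnessTables A L} := by
  have e : (fun i => (0 : ι → ℕ) i + depth A L i) = depth A L := funext fun i => Nat.zero_add _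
  change {τ | (∀ b ∈ J, τ ∈ eventTables A (fun i => (0 : ι → ℕ) i + depth A L i) b) ∧
    τ ∈ witnessTables A L} = _
  rw [e]

theorem determinedBy_witnessTables (L : List (Finset α)) :
    DeterminedBy (witnessTables A L) (positions A L) := by
  induction L with
  | nil => exact fun _ _ _ => Iff.rfl
  | cons J L ih =>
    intro v w h
    rw [witnessTables_cons]
    refine and_congr (forall₂_congr fun b hb => determinedBy_eventTables _ b v w fun p hp => ?_)
      (ih v w fun p hp => h p ?_)
    · obtain ⟨i, hi, rfl⟩ := Finset.mem_image.1 hp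
      refine h _ (mem_positions.2 ?_)
      have : ∃ b ∈ J, i ∈ vbl (A b) := ⟨b, hb, hi⟩
      simp [depth, this]
    · rw [mem_positions] at hp ⊢
      exact hp.trans_le (Nat.le_add_right _ _)

variable [∀ i, MeasurableSpace (E i)]

theorem measurableSet_witnessTables (hA : ∀ a, MeasurableSet (A a)) (L : List (Finset α)) :
    MeasurableSet (witnessTables A L) := by
  induction L with
  | nil => exact MeasurableSet.univ
  | cons J L ih =>
    rw [witnessTables_cons]
    exact measurableSet_layerTables hA _ J ih

variable {Ω Ω' : Type*} [MeasurableSpace Ω] [MeasurableSpace Ω'] {μ : Measure Ω} {ν : Measure Ω'}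
  {X : ∀ i, Ω → E i} {src : ∀ i, ℕ → Ω' → E i}

/-- The indices `(i, u i)` select one sample per variable, so both joint laws are the product of the
same marginals. -/
theorem measure_eventTables (hX : ∀ i, Measurable (X i)) (hind : iIndepFun X μ)
    (hsrc : ∀ i k, Measurable (src i k)) (hid : ∀ i k, IdentDistrib (src i k) (X i) ν μ)
    (hsi : iIndepFun (fun p : ι × ℕ => src p.1 p.2) ν) (hA : ∀ a, MeasurableSet (A a))
    (u : ι → ℕ) (b : α) :
    ν {ω | (fun p : ι × ℕ => src p.1 p.2 ω) ∈ eventTables A u b} =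
      μ {ω | (fun i => X i ω) ∈ A b} := by
  have hu : iIndepFun (fun i => src i (u i)) ν :=
    hsi.precomp (g := fun i => (i, u i)) fun i j h => (Prod.mk.inj h).1
  have e : ν.map (fun ω i => src i (u i) ω) = μ.map (fun ω i => X i ω) := by
    rw [hu.map_fun_eq_pi_map fun i => (hsrc i _).aemeasurable,
      hind.map_fun_eq_pi_map fun i => (hX i).aemeasurable]
    exact congrArg Measure.pi (funext fun i => (hid i _).map_eq)
  have := congrArg (fun m => m (A b)) e
  simp only [Measure.map_apply (measurable_pi_iff.2 fun i => hsrc i (u i)) (hA b),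
    Measure.map_apply (measurable_pi_iff.2 hX) (hA b)] at this
  exact this

/-- Members of `J` have disjoint variables and read entries outside `S`, so each can be split off by
independence. In the application `B` concerns the deeper layers, which read only indices below `u`.
-/
theorem measure_layerTables_le (hsrc : ∀ i k, Measurable (src i k))
    (hsi : iIndepFun (fun p : ι × ℕ => src p.1 p.2) ν) (hA : ∀ a, MeasurableSet (A a))
    {q : α → ℝ} (hq : ∀ a, 0 ≤ q a) {u : ι → ℕ} (hνq : ∀ b,
      ν {ω | (fun p : ι × ℕ => src p.1 p.2 ω) ∈ eventTables A u b} ≤ ENNReal.ofReal (q b))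
    {B : Set (∀ p : ι × ℕ, E p.1)} (hB : MeasurableSet B) {S : Finset (ι × ℕ)}
    (hS : DeterminedBy B S) (hSu : ∀ i, (i, u i) ∉ S) {w : ℝ}
    (hνB : ν {ω | (fun p : ι × ℕ => src p.1 p.2 ω) ∈ B} ≤ ENNReal.ofReal w) {J : Finset α}
    (hJ : (J : Set α).PairwiseDisjoint fun b => vbl (A b)) :
    ν {ω | (fun p : ι × ℕ => src p.1 p.2 ω) ∈ {τ | (∀ b ∈ J, τ ∈ eventTables A u b) ∧ τ ∈ B}} ≤
      ENNReal.ofReal ((∏ b ∈ J, q b) * w) := by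
  induction J using Finset.induction_on with
  | empty => simpa using hνB
  | insert b J hb ih =>
    have hdet : DeterminedBy {τ | (∀ b ∈ J, τ ∈ eventTables A u b) ∧ τ ∈ B}
        (S ∪ J.biUnion fun c => (vbl (A c)).image fun i => (i, u i)) := fun v w h =>
      and_congr (forall₂_congr fun c hc => determinedBy_eventTables u c v w fun p hp =>
          h p (Finset.mem_union_right _ (Finset.mem_biUnion.2 ⟨c, hc, hp⟩)))
        (hS v w fun p hp => h p (Finset.mem_union_left _ hp))
    have hdisj : Disjoint ((vbl (A b)).image fun i => (i, u i))
        (S ∪ J.biUnion fun c => (vbl (A c)).image fun i => (i, u i)) := by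
      refine Finset.disjoint_left.2 fun p hp hp' => ?_
      obtain ⟨i, hi, rfl⟩ := Finset.mem_image.1 hp
      rcases Finset.mem_union.1 hp' with h | h
      · exact hSu i h
      · obtain ⟨c, hc, h⟩ := Finset.mem_biUnion.1 h
        obtain ⟨j, hj, hij⟩ := Finset.mem_image.1 h
        obtain rfl : j = i := (Prod.mk.inj hij).1
        have hbc : b ≠ c := fun h => hb (h ▸ hc)
        exact Finset.disjoint_left.1 (hJ (by simp) (by simp [hc]) hbc) hi hj
    have e : {ω | (fun p : ι × ℕ => src p.1 p.2 ω) ∈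
          {τ | (∀ c ∈ insert b J, τ ∈ eventTables A u c) ∧ τ ∈ B}} =
        {ω | (fun p : ι × ℕ => src p.1 p.2 ω) ∈ eventTables A u b ∧
          (fun p : ι × ℕ => src p.1 p.2 ω) ∈
            {τ | (∀ c ∈ J, τ ∈ eventTables A u c) ∧ τ ∈ B}} := by
      ext
      simp only [Finset.forall_mem_insert, Set.mem_ofPred_eq, and_assoc]
    rw [e, measure_inter_of_determinedBy (fun p : ι × ℕ => hsrc p.1 p.2) hsi
      (measurableSet_eventTables hA u b) (measurableSet_layerTables hA u J hB)
      (determinedBy_eventTables u b) hdet hdisj, Finset.prod_insert hb, mul_assoc,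
      ENNReal.ofReal_mul (hq b)]
    exact mul_le_mul' (hνq b) (ih (hJ.subset (by simp)))

variable [Fintype α] [IsProbabilityMeasure ν]

theorem measure_witnessTables_le (hsrc : ∀ i k, Measurable (src i k))
    (hsi : iIndepFun (fun p : ι × ℕ => src p.1 p.2) ν) (hA : ∀ a, MeasurableSet (A a))
    {q : α → ℝ} (hq : ∀ a, 0 ≤ q a) (hνq : ∀ u b,
      ν {ω | (fun p : ι × ℕ => src p.1 p.2 ω) ∈ eventTables A u b} ≤ ENNReal.ofReal (q b))
    {I : Finset α} {L : List (Finset α)} (hL : IsLayered A I L) :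
    ν {ω | (fun p : ι × ℕ => src p.1 p.2 ω) ∈ witnessTables A L} ≤
      ENNReal.ofReal (weight q L) := by
  induction L generalizing I with
  | nil => simp [weight, prob_le_one]
  | cons J L ih =>
    rw [witnessTables_cons]
    exact measure_layerTables_le hsrc hsi hA hq (hνq _) (measurableSet_witnessTables hA L)
      (determinedBy_witnessTables L) (fun i h => (mem_positions.1 h).false) (ih hL.2.2.2) hL.2.2.1

/-- The number of lists of layers with first layer `{a}` all of whose events happen. -/
noncomputable def witnessCount (A : α → Set (∀ i, E i)) (a : α) (τ : ∀ p : ι × ℕ, E p.1) : ℝ≥0∞ :=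
  ∑' L : {L // IsLayered A {a} L}, (witnessTables A ({a} :: L.1)).indicator 1 τ

theorem measurable_witnessCount (hA : ∀ a, MeasurableSet (A a)) (a : α) :
    Measurable (witnessCount A a) :=
  Measurable.tsum fun _ => measurable_one.indicator (measurableSet_witnessTables hA _)

theorem lintegral_witnessCount_le {x : α → ℝ} (hx : ∀ a, x a ∈ Set.Ioo (0 : ℝ) 1)
    (hsrc : ∀ i k, Measurable (src i k)) (hsi : iIndepFun (fun p : ι × ℕ => src p.1 p.2) ν)
    (hA : ∀ a, MeasurableSet (A a))
    (hνx : ∀ u b, ν {ω | (fun p : ι × ℕ => src p.1 p.2 ω) ∈ eventTables A u b} ≤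
      ENNReal.ofReal (x b * ∏ c ∈ neighbors A b, (1 - x c))) (a : α) :
    ∫⁻ ω, witnessCount A a (fun p => src p.1 p.2 ω) ∂ν ≤ ENNReal.ofReal (x a / (1 - x a)) := by
  set q : α → ℝ := fun a => x a * ∏ b ∈ neighbors A a, (1 - x b)
  have hq0 : ∀ a, 0 ≤ q a := fun a => mul_nonneg (hx a).1.le
    (Finset.prod_nonneg fun b _ => by linarith [(hx b).2])
  have hm : Measurable fun ω => fun p : ι × ℕ => src p.1 p.2 ω :=
    measurable_pi_iff.2 fun p => hsrc p.1 p.2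
  have hterm : ∀ L : {L // IsLayered A {a} L},
      ∫⁻ ω, (witnessTables A ({a} :: L.1)).indicator 1 (fun p : ι × ℕ => src p.1 p.2 ω) ∂ν ≤
        ENNReal.ofReal (q a * weight q L.1) := fun L => by
    have hL : IsLayered A {a} ({a} :: L.1) :=
      ⟨by simp, fun b hb => by simp_all [closedNeighbors], by simp, L.2⟩
    have h := measure_witnessTables_le hsrc hsi hA hq0 hνx hL
    rw [weight, Finset.prod_singleton] at h
    refine le_of_eq_of_le ?_ h
    exact lintegral_indicator_one (μ := ν) (s := {ω | (fun p : ι × ℕ => src p.1 p.2 ω) ∈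
      witnessTables A ({a} :: L.1)}) (hm (measurableSet_witnessTables hA _))
  simp only [witnessCount]
  have hmeas : ∀ L : {L // IsLayered A {a} L}, AEMeasurable (fun ω =>
      (witnessTables A ({a} :: L.1)).indicator (1 : (∀ p : ι × ℕ, E p.1) → ℝ≥0∞) fun p => src p.1 p.2 ω) ν :=
    fun L =>
    ((measurable_one.indicator (measurableSet_witnessTables hA _)).comp hm).aemeasurable
  rw [lintegral_tsum hmeas]
  -- A finite partial sum involves only lists of bounded length, so the bound on `layerings`,
  -- uniform in the length, suffices.
  refine (ENNReal.tsum_le_tsum hterm).trans ?_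
  rw [ENNReal.tsum_eq_iSup_sum]
  refine iSup_le fun s => ?_
  rw [← ENNReal.ofReal_sum_of_nonneg fun L _ => mul_nonneg (hq0 a) (weight_nonneg hq0 _)]
  refine ENNReal.ofReal_le_ofReal ?_
  rw [← Finset.mul_sum, ← mul_prod_inv_one_sub_eq (A := A) hx a]
  refine mul_le_mul_of_nonneg_left ?_ (hq0 a)
  have hsub : s.image Subtype.val ⊆
      layerings A (s.sup fun L => L.1.length) {a} := fun L hL => by
    obtain ⟨L, hLs, rfl⟩ := Finset.mem_image.1 hL
    exact L.2.mem_layerings (Finset.le_sup (f := fun L => L.1.length) hLs)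
  calc ∑ L ∈ s, weight q L.1
      = ∑ L ∈ s.image Subtype.val, weight q L :=
        (Finset.sum_image Subtype.val_injective.injOn).symm
    _ ≤ ∑ L ∈ layerings A (s.sup fun L => L.1.length) {a}, weight q L :=
        Finset.sum_le_sum_of_subset_of_nonneg hsub fun L _ _ => weight_nonneg hq0 L
    _ ≤ _ := (sum_weight_layerings_le hx _ _).trans_eq (Finset.prod_singleton _ _)

end Probability

/-! ### Resampling counts and termination. -/

section Counting

variable {ι : Type*} [Fintype ι] {E : ι → Type*} {α : Type*}
  {A : α → Set (∀ i, E i)} {src : ∀ i, ℕ → E i} {C : ℕ → Option α}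

theorem IsLog.exists_eq_none (h : IsLog A src C) (hC : totalCount C < ∞) :
    ∃ t, C t = none ∧ ∀ a, (stateAt A src C t).val ∉ A a := by
  have hfin : {t | C t ≠ none}.Finite := by
    rw [← Set.encard_lt_top_iff]
    simpa [totalCount, lt_top_iff_ne_top] using hC
  obtain ⟨t, ht⟩ := hfin.exists_notMem
  have ht : C t = none := by simpa using ht
  have := h t
  rw [ht] at this
  exact ⟨t, ht, this⟩

variable [Fintype α]

/-- Sending each resampling of `a` to its causal past is injective: the number of layers containing
`a` recovers which resampling of `a` it is. -/
theorem IsLog.resampleCount_le (h : IsLog A src C)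
    (hA : ∀ a, (A a).Nonempty → (vbl (A a)).Nonempty) (a : α) :
    resampleCount C a ≤ witnessCount A a (fun p => src p.1 p.2) := by
  let φ : {t | C t = some a} → {L // IsLayered A {a} L} := fun t =>
    ⟨history A C {a} t [], IsLayered.history trivial⟩
  have hφ : Function.Injective φ := by
    intro s t hst
    have ha : (vbl (A a)).Nonempty := hA a ⟨_, h.mem s.2⟩
    have e := congrArg (fun L => L.1.countP (fun K => a ∈ K)) hst
    simp only [φ, countP_history ha] at e
    exact Subtype.ext (Nat.count_injective (p := fun s => C s = some a) s.2 t.2 (by simpa using e))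
  rw [resampleCount, ← ENNReal.tsum_set_one, witnessCount]
  refine le_trans (ENNReal.tsum_le_tsum fun t => ?_)
    (ENNReal.tsum_comp_le_tsum_of_injective hφ _)
  rw [Set.indicator_of_mem]
  · rfl
  · exact h.witnessed t.2

theorem totalCount_eq_sum (C : ℕ → Option α) : totalCount C = ∑ a, resampleCount C a := by
  have e : {t | C t ≠ none} = ⋃ a ∈ (Finset.univ : Finset α), {t | C t = some a} := by
    ext t
    simp [Option.ne_none_iff_exists']
  simp only [totalCount, resampleCount, ← Measure.count_apply (MeasurableSet.of_discrete)]
  rw [e, measure_biUnion_finset (fun a _ b _ hab => Set.disjoint_left.2 fun t ha hb =>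
    hab (Option.some.inj (ha.symm.trans hb))) fun _ _ => MeasurableSet.of_discrete]

end Counting

end MoserTardos

/-! ### Assembly of the theorem. -/

theorem theorem2 {Ω : Type*} [MeasurableSpace Ω] (μ : Measure Ω) [IsProbabilityMeasure μ]
    {ι : Type*} [Fintype ι] {E : ι → Type*} [∀ i, MeasurableSpace (E i)]
    (X : ∀ i, Ω → E i) (hX : ∀ i, Measurable (X i)) (hind : iIndepFun X μ)
    {α : Type*} [Fintype α] (A : α → Set (∀ i, E i)) (hA : ∀ a, MeasurableSet (A a))
    (x : α → ℝ) (hx : ∀ a, x a ∈ Set.Ioo (0 : ℝ) 1)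
    (hLLL : ∀ a, μ.real {ω | (fun i => X i ω) ∈ A a} ≤
      x a * ∏ b ∈ MoserTardos.neighbors A a, (1 - x b)) :
    (∃ ω, ∀ a, (fun i => X i ω) ∉ A a) ∧
    ∀ {Ω' : Type*} [MeasurableSpace Ω'] (ν : Measure Ω') [IsProbabilityMeasure ν]
      (src : ∀ i, ℕ → Ω' → E i) (C : ℕ → Ω' → Option α),
      MoserTardos.IsExecution μ X A ν src C →
      (∀ a, ∫⁻ ω, MoserTardos.resampleCount (fun t => C t ω) a ∂ν ≤
        ENNReal.ofReal (x a / (1 - x a))) ∧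
      ∫⁻ ω, MoserTardos.totalCount (fun t => C t ω) ∂ν ≤
        ENNReal.ofReal (∑ a, x a / (1 - x a)) ∧
      ∀ᵐ ω ∂ν, ∃ t, C t ω = none ∧
        ∀ a, (MoserTardos.stateAt A (fun i k => src i k ω) (fun s => C s ω) t).val ∉ A a := by
  refine ⟨MoserTardos.exists_forall_notMem hX hind hA hx hLLL, ?_⟩
  intro Ω' _ ν _ src C hC
  have hνx : ∀ u b, ν {ω | (fun p : ι × ℕ => src p.1 p.2 ω) ∈ MoserTardos.eventTables A u b} ≤
      ENNReal.ofReal (x b * ∏ c ∈ MoserTardos.neighbors A b, (1 - x c)) := fun u b => by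
    rw [MoserTardos.measure_eventTables hX hind hC.measurable_src hC.identDistrib_src hC.indep_src
      hA u b, ← ofReal_measureReal]
    exact ENNReal.ofReal_le_ofReal (hLLL b)
  have hint := MoserTardos.lintegral_witnessCount_le hx hC.measurable_src hC.indep_src hA hνx
  -- A possible event that depends on no variable would be certain, contradicting a bound strictly
  -- below `1`.
  have hne : ∀ a, (A a).Nonempty → (MoserTardos.vbl (A a)).Nonempty := by
    rintro a ⟨v, hv⟩
    by_contra h
    have huniv : A a = Set.univ := Set.eq_univ_of_forall fun w =>
      (MoserTardos.determinedBy_vbl (A a) v w fun i hi => absurd ⟨i, hi⟩ h).1 hv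
    have h1 := hLLL a
    have h2 : ∏ b ∈ MoserTardos.neighbors A a, (1 - x b) ≤ 1 :=
      Finset.prod_le_one (fun b _ => by linarith [(hx b).2]) fun b _ => by linarith [(hx b).1]
    simp only [huniv, Set.mem_univ, Set.ofPred_true, probReal_univ] at h1
    nlinarith [(hx a).1, (hx a).2]
  have hle : ∀ a ω, MoserTardos.resampleCount (fun t => C t ω) a ≤
      MoserTardos.witnessCount A a (fun p => src p.1 p.2 ω) := fun a ω =>
    (hC.isLog ω).resampleCount_le hne a
  have htotal : ∀ ω, MoserTardos.totalCount (fun t => C t ω) ≤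
      ∑ a, MoserTardos.witnessCount A a (fun p => src p.1 p.2 ω) := fun ω => by
    rw [MoserTardos.totalCount_eq_sum]
    exact Finset.sum_le_sum fun a _ => hle a ω
  have hm : ∀ a, Measurable fun ω => MoserTardos.witnessCount A a (fun p => src p.1 p.2 ω) :=
    fun a => (MoserTardos.measurable_witnessCount hA a).comp
      (measurable_pi_iff.2 fun p => hC.measurable_src p.1 p.2)
  have hsum : ∫⁻ ω, ∑ a, MoserTardos.witnessCount A a (fun p => src p.1 p.2 ω) ∂ν ≤
      ENNReal.ofReal (∑ a, x a / (1 - x a)) := by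
    rw [lintegral_finsetSum _ fun a _ => hm a, ENNReal.ofReal_sum_of_nonneg fun a _ =>
      div_nonneg (hx a).1.le (by linarith [(hx a).2])]
    exact Finset.sum_le_sum fun a _ => hint a
  refine ⟨fun a => (lintegral_mono (hle a)).trans (hint a), (lintegral_mono htotal).trans hsum, ?_⟩
  -- The measurable majorant has finite integral, so it is finite almost everywhere, and with it the
  -- number of steps.
  filter_upwards [ae_lt_top (Finset.measurable_sum _ fun a _ => hm a)
    (hsum.trans_lt ENNReal.ofReal_lt_top).ne] with ω hω
  exact (hC.isLog ω).exists_eq_none ((htotal ω).trans_lt hω)
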